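/- Let $I=[a,b]$ with $a<b$ be a bounded interval. For an interval $J\subset I$ of positive length and an integrable function $f$ on $J$ write $\langle f\rangle_J=\frac1{|J|}\int_J f$; for measurable $f\ge 0$ the same notation is used with values in $[0,\infty]$. For a real-valued $\varphi\in L^1(I)$ let $$\|\varphi\|_{\mathrm{BMO}(I)}=\Bigl(\sup_{J\subset I}\bigl\langle|\varphi-\langle\varphi\rangle_J|^2\bigr\rangle_J\Bigr)^{1/2}\in[0,\infty],$$ the supremum being over all subintervals $J$ of $I$ of positive length, and for $\varepsilon\ge0$ let $\mathrm{BMO}_\varepsilon(I)=\{\varphi\in L^1(I):\|\varphi\|_{\mathrm{BMO}(I)}\le\varepsilon\}$. **Theorem.** 1. For every $0\le\varepsilon<1$ and every $\varphi\in\mathrm{BMO}_\varepsilon(I)$, the function $e^\varphi$ is integrable on $I$ and $$\langle e^\varphi\rangle_I\le\frac{e^{-\varepsilon}}{1-\varepsilon}\,e^{\langle\varphi\rangle_I}.$$ 2. The constant is sharp: for every $0\le\varepsilon<1$, if $C\in\mathbb R$ is such that $\langle e^\varphi\rangle_I\le C\,e^{\langle\varphi\rangle_I}$ for all $\varphi\in\mathrm{BMO}_\varepsilon(I)$,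 then $C\ge\frac{e^{-\varepsilon}}{1-\varepsilon}$. 3. The threshold $\varepsilon_0=1$ is sharp: for every $\varepsilon\ge1$ there is no finite constant $C$ such that $\langle e^\varphi\rangle_I\le C\,e^{\langle\varphi\rangle_I}$ for all $\varphi\in\mathrm{BMO}_\varepsilon(I)$ (where $\langle e^\varphi\rangle_I=\infty$ if $e^\varphi$ is not integrable on $I$). -/

import Mathlib

open MeasureTheory Set
open scoped ENNReal

noncomputable section

namespace JohnNirenberg

/-- The `L²`-based `BMO` norm of `φ` on the interval `I = [a, b]`, as an extended nonnegative
real: the square root of the supremum over all nondegenerate subintervals `J = [c, d]` of `I` of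
the mean oscillation `⟨|φ - ⟨φ⟩_J|²⟩_J`. The oscillation is a Lebesgue average with values in
`[0, ∞]`, so that it is `∞` if `φ` is not square integrable on `J`. -/
def bmoNorm (a b : ℝ) (φ : ℝ → ℝ) : ℝ≥0∞ :=
  (⨆ (c : ℝ) (d : ℝ) (_ : a ≤ c ∧ c < d ∧ d ≤ b),
    ⨍⁻ x in Icc c d, ‖φ x - ⨍ y in Icc c d, φ y‖ₑ ^ 2 ∂volume) ^ (1 / 2 : ℝ)

/-- `BMO(I)` for `I = [a, b]`: integrable functions on `I` whose `BMO` norm is finite. Only the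
values of `φ` on `I` matter. -/
def BMO (a b : ℝ) : Set (ℝ → ℝ) :=
  {φ | IntegrableOn φ (Icc a b) ∧ bmoNorm a b φ < ∞}

/-- `BMO_ε(I)` for `I = [a, b]`: the closed `ε`-ball of `BMO(I)` around `0`. -/
def BMOBall (a b ε : ℝ) : Set (ℝ → ℝ) :=
  {φ | φ ∈ BMO a b ∧ bmoNorm a b φ ≤ ENNReal.ofReal ε}

/-- The integral John–Nirenberg inequality `⟨e^φ⟩_I ≤ C e^{⟨φ⟩_I}` on `I = [a, b]`; it includes
the claim that `⟨e^φ⟩_I` is finite. -/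
def ExpInequality (a b C : ℝ) (φ : ℝ → ℝ) : Prop :=
  IntegrableOn (fun x => Real.exp (φ x)) (Icc a b) ∧
    ⨍ x in Icc a b, Real.exp (φ x) ≤ C * Real.exp (⨍ x in Icc a b, φ x)

end JohnNirenberg

end

/-!
# The integral John–Nirenberg inequality with sharp constants

**The inequality.** Fix `ε < δ < 1`. The parabola `tangentParabola δ c` lies above `exp` on
`(-∞, c + δ]` (`exp_le_tangentParabola`), and its mean under a distribution depends only on the mean
and the variance of the distribution. If the mean is `α` and the variance is at most
`ε² = δ² - h²`, then the mean of the parabola based at `c = α - δ` only decreases when `c` is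
replaced by `c + h` (`mean_tangentParabola_shift_le`). These parabolas are the supporting planes of
the Bellman function of the problem, and the argument below is a Bellman induction over finitely
spaced levels, which uses neither a rearrangement nor a differential equation.

Let `m` be the mean of `φ` over `(a, b)`. For a level `α > m`, a variant of the rising sun lemma
(`eq_of_component_risingSunSet`) gives an open set `A` whose components all have mean exactly `α`
and such that `φ ≤ α` almost everywhere off `A`; summing the `BMO` bound over the components shows
that `φ` has mean `α` and variance at most `ε²` on `A` as well. These sets decrease with `α`. Take
the levels `m, m + h, m + 2h, …` and the corresponding sets `A₀ = (a, b) ⊇ A₁ ⊇ A₂ ⊇ …`. On `Aₙ` the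
parabola of level `n` has a larger integral than the parabola of level `n + 1`; the latter dominates
`e^φ` on `Aₙ \ Aₙ₊₁` and is carried over to the next step on `Aₙ₊₁`. Hence `∫ e^φ` is at most the
integral over `(a, b)` of the parabola based at `m - δ`, which is at most
`(b - a) e^(m - δ) / (1 - δ)` (`setLIntegral_exp_le`). Finally let `δ` tend to `ε`.

**Sharpness.** For `0 ≤ c < d` the variance of `log` on `[c, d]` is
`1 - c d (log d - log c)² / (d - c)² ≤ 1`, so `-ε log (x - a)` lies in the `ε`-ball of `BMO`
(`logExtremal_mem_BMOBall`). It gives equality in the inequality when `ε < 1`, and for `ε = 1` its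
exponential is `1 / (x - a)`, which is not integrable.
-/

namespace JohnNirenberg

open Filter Topology

/-! ### Elementary inequalities for the exponential -/

lemma exp_neg_le_quadratic {w : ℝ} (hw : 0 ≤ w) : Real.exp (-w) ≤ 1 - w + w ^ 2 / 2 := by
  have hd : ∀ x : ℝ, HasDerivAt (fun x => 1 - x + x ^ 2 / 2 - Real.exp (-x))
      (-1 + x + Real.exp (-x)) x := by
    intro x
    have h1 := ((hasDerivAt_id x).neg).exp
    have h2 := ((hasDerivAt_id x).pow 2).div_const 2
    have h3 := (((hasDerivAt_id x).const_sub 1).add h2).sub h1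
    refine h3.congr_deriv ?_
    simp
  have hm : MonotoneOn (fun x => 1 - x + x ^ 2 / 2 - Real.exp (-x)) (Ici 0) := by
    refine monotoneOn_of_deriv_nonneg (convex_Ici 0)
      (fun x _ => (hd x).continuousAt.continuousWithinAt)
      (fun x _ => (hd x).differentiableAt.differentiableWithinAt) fun x _ => ?_
    rw [(hd x).deriv]
    linarith [Real.add_one_le_exp (-x)]
  have := hm (mem_Ici.2 le_rfl) (mem_Ici.2 hw) hw
  simp at this
  linarith

lemma cubic_le_exp_neg {w : ℝ} (hw : 0 ≤ w) :
    1 - w + w ^ 2 / 2 - w ^ 3 / 6 ≤ Real.exp (-w) := by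
  have hd : ∀ x : ℝ, HasDerivAt (fun x => Real.exp (-x) - (1 - x + x ^ 2 / 2 - x ^ 3 / 6))
      (1 - x + x ^ 2 / 2 - Real.exp (-x)) x := by
    intro x
    have h1 := ((hasDerivAt_id x).neg).exp
    have h2 := ((hasDerivAt_id x).pow 2).div_const 2
    have h4 := ((hasDerivAt_id x).pow 3).div_const 6
    have h3 := h1.sub ((((hasDerivAt_id x).const_sub 1).add h2).sub h4)
    refine h3.congr_deriv ?_
    simp
    ring
  have hm : MonotoneOn (fun x => Real.exp (-x) - (1 - x + x ^ 2 / 2 - x ^ 3 / 6)) (Ici 0) := by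
    refine monotoneOn_of_deriv_nonneg (convex_Ici 0)
      (fun x _ => (hd x).continuousAt.continuousWithinAt)
      (fun x _ => (hd x).differentiableAt.differentiableWithinAt) fun x hx => ?_
    rw [(hd x).deriv]
    rw [interior_Ici, mem_Ioi] at hx
    linarith [exp_neg_le_quadratic hx.le]
  have := hm (mem_Ici.2 le_rfl) (mem_Ici.2 hw) hw
  simp at this
  linarith

lemma one_sub_mul_exp_le {v : ℝ} (hv : 0 ≤ v) : (1 - v) * Real.exp v ≤ 1 - v ^ 2 / 2 := by
  have hd : ∀ x : ℝ, HasDerivAt (fun x => 1 - x ^ 2 / 2 - (1 - x) * Real.exp x)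
      (x * (Real.exp x - 1)) x := by
    intro x
    have h2 := ((hasDerivAt_id x).pow 2).div_const 2
    have h3 := ((h2.const_sub 1)).sub
      (((hasDerivAt_id x).const_sub 1).mul (Real.hasDerivAt_exp x))
    refine h3.congr_deriv ?_
    simp
    ring
  have hm : MonotoneOn (fun x => 1 - x ^ 2 / 2 - (1 - x) * Real.exp x) (Ici 0) := by
    refine monotoneOn_of_deriv_nonneg (convex_Ici 0)
      (fun x _ => (hd x).continuousAt.continuousWithinAt)
      (fun x _ => (hd x).differentiableAt.differentiableWithinAt) fun x hx => ?_
    rw [(hd x).deriv]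
    rw [interior_Ici, mem_Ioi] at hx
    exact mul_nonneg hx.le (by linarith [Real.add_one_le_exp x])
  have := hm (mem_Ici.2 le_rfl) (mem_Ici.2 hv) hv
  simp at this
  linarith

/-- The parabola which touches the graph of `exp` at `c`, with second derivative `e^c / (1 - δ)`
there. In the variables `(u, u²)` it is affine: it is a supporting plane of the Bellman function of
the problem. -/
noncomputable def tangentParabola (δ c u : ℝ) : ℝ :=
  Real.exp c * (1 + (u - c) + (u - c) ^ 2 / (2 * (1 - δ)))

lemma exp_le_tangentParabola {δ c u : ℝ} (h0 : 0 ≤ δ) (h1 : δ < 1) (hu : u ≤ c + δ) :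
    Real.exp u ≤ tangentParabola δ c u := by
  have key : Real.exp (u - c) ≤ 1 + (u - c) + (u - c) ^ 2 / (2 * (1 - δ)) := by
    generalize hv : u - c = v
    have hvδ : v ≤ δ := by linarith
    rcases le_total v 0 with h | h
    · have h2 := exp_neg_le_quadratic (w := -v) (by linarith)
      rw [neg_neg, neg_sq] at h2
      have h3 : v ^ 2 / 2 ≤ v ^ 2 / (2 * (1 - δ)) :=
        div_le_div_of_nonneg_left (sq_nonneg v) (by linarith) (by linarith)
      linarith
    · have h2 := one_sub_mul_exp_le h
      have h3 : v ^ 2 / (2 * (1 - v)) ≤ v ^ 2 / (2 * (1 - δ)) :=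
        div_le_div_of_nonneg_left (sq_nonneg v) (by linarith) (by linarith)
      have h4 : Real.exp v ≤ 1 + v + v ^ 2 / (2 * (1 - v)) := by
        have hpos : 0 < 1 - v := by linarith
        have : 1 + v + v ^ 2 / (2 * (1 - v)) = (1 - v ^ 2 / 2) / (1 - v) := by
          field_simp
          ring
        rw [this, le_div_iff₀ hpos]
        linarith
      linarith
  calc Real.exp u = Real.exp c * Real.exp (u - c) := by rw [← Real.exp_add]; ring_nf
    _ ≤ _ := mul_le_mul_of_nonneg_left key (Real.exp_pos c).le

lemma tangentParabola_nonneg {δ : ℝ} (h0 : 0 ≤ δ) (h1 : δ < 1) (c u : ℝ) :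
    0 ≤ tangentParabola δ c u := by
  refine mul_nonneg (Real.exp_pos c).le ?_
  have h3 : (u - c) ^ 2 / 2 ≤ (u - c) ^ 2 / (2 * (1 - δ)) :=
    div_le_div_of_nonneg_left (sq_nonneg _) (by linarith) (by linarith)
  nlinarith [sq_nonneg (u - c + 1)]

/-- The mean of `tangentParabola δ c` under a distribution with mean `α` and variance
`V ≤ δ² - h²` decreases when `c` moves from `α - δ` to `α - δ + h`. -/
lemma mean_tangentParabola_shift_le {δ h V α : ℝ} (h0 : 0 ≤ δ) (h1 : δ < 1) (hh : 0 ≤ h)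
    (hV0 : 0 ≤ V) (hV : V ≤ δ ^ 2 - h ^ 2) :
    Real.exp (α + h - δ) * (1 + (δ - h) + (V + (δ - h) ^ 2) / (2 * (1 - δ))) ≤
      Real.exp (α - δ) * (1 + δ + (V + δ ^ 2) / (2 * (1 - δ))) := by
  have hpos : 0 < 1 - δ := by linarith
  have e1 : 1 + (δ - h) + (V + (δ - h) ^ 2) / (2 * (1 - δ)) =
      (2 - δ ^ 2 + V - 2 * h + h ^ 2) / (2 * (1 - δ)) := by
    field_simp
    ring
  have e2 : 1 + δ + (V + δ ^ 2) / (2 * (1 - δ)) = (2 - δ ^ 2 + V) / (2 * (1 - δ)) := by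
    field_simp
    ring
  rw [e1, e2, show α + h - δ = (α - δ) + h by ring, Real.exp_add, mul_assoc]
  refine mul_le_mul_of_nonneg_left ?_ (Real.exp_pos _).le
  rw [← mul_div_assoc]
  refine div_le_div_of_nonneg_right ?_ (by linarith)
  have hc := cubic_le_exp_neg hh
  have hK : 2 - δ ^ 2 + V - 2 * h + h ^ 2 ≤ Real.exp (-h) * (2 - δ ^ 2 + V) := by
    have hK0 : 0 ≤ 2 - δ ^ 2 + V := by nlinarith
    have a1 := mul_le_mul_of_nonneg_right hc hK0
    have a2 : 0 ≤ h - h ^ 2 / 2 + h ^ 3 / 6 := by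
      have : h - h ^ 2 / 2 + h ^ 3 / 6 = h * ((h - 3 / 2) ^ 2 + 15 / 4) / 6 := by ring
      rw [this]; positivity
    have a3 : (2 - δ ^ 2 + V) * (h - h ^ 2 / 2 + h ^ 3 / 6) ≤
        (2 - h ^ 2) * (h - h ^ 2 / 2 + h ^ 3 / 6) :=
      mul_le_mul_of_nonneg_right (by linarith) a2
    have a4 : (2 - h ^ 2) * (h - h ^ 2 / 2 + h ^ 3 / 6) ≤ 2 * h - h ^ 2 := by
      have : 2 * h - h ^ 2 - (2 - h ^ 2) * (h - h ^ 2 / 2 + h ^ 3 / 6) =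
        h ^ 3 * ((h - 3 / 2) ^ 2 + 7 / 4) / 6 := by ring
      have : 0 ≤ h ^ 3 * ((h - 3 / 2) ^ 2 + 7 / 4) / 6 := by positivity
      linarith
    linarith
  calc Real.exp h * (2 - δ ^ 2 + V - 2 * h + h ^ 2)
      ≤ Real.exp h * (Real.exp (-h) * (2 - δ ^ 2 + V)) :=
        mul_le_mul_of_nonneg_left hK (Real.exp_pos h).le
    _ = 2 - δ ^ 2 + V := by rw [← mul_assoc, ← Real.exp_add]; simp

/-! ### Integrals over the components of an open set -/

/-- A bounded connected component of an open subset of the line is an open interval whose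
endpoints do not belong to the set. -/
lemma exists_connectedComponentIn_eq_Ioo {a b x : ℝ} {U : Set ℝ} (hU : IsOpen U)
    (hUab : U ⊆ Ioo a b) (hx : x ∈ U) :
    ∃ c d, c < d ∧ connectedComponentIn U x = Ioo c d ∧ a ≤ c ∧ d ≤ b ∧ c ∉ U ∧ d ∉ U := by
  set K := connectedComponentIn U x with hK
  have hKU : K ⊆ U := connectedComponentIn_subset U x
  have hxK : x ∈ K := mem_connectedComponentIn hx
  have hconn : IsConnected K := isConnected_connectedComponentIn_iff.2 hx
  have hopen : IsOpen K := hU.connectedComponentIn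
  have hbb : BddBelow K := ⟨a, fun y hy => (hUab (hKU hy)).1.le⟩
  have hba : BddAbove K := ⟨b, fun y hy => (hUab (hKU hy)).2.le⟩
  have hmax : ∀ s : Set ℝ, IsPreconnected s → x ∈ s → s ⊆ U → s ⊆ K := fun s h1 h2 h3 =>
    h1.subset_connectedComponentIn h2 h3
  have hsub := hconn.Ioo_csInf_csSup_subset hbb hba
  have hinf : sInf K ∉ K := fun h => by
    obtain ⟨l, hl, hl'⟩ := (mem_nhdsLE_iff_exists_Ioc_subset).1
      (mem_nhdsWithin_of_mem_nhds (t := Iic (sInf K)) (hopen.mem_nhds h))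
    have h1 : (l + sInf K) / 2 ∈ K := hl' ⟨by linarith [mem_Iio.1 hl], by linarith [mem_Iio.1 hl]⟩
    linarith [csInf_le hbb h1, mem_Iio.1 hl]
  have hsup : sSup K ∉ K := fun h => by
    obtain ⟨l, hl, hl'⟩ := (mem_nhdsGE_iff_exists_Ico_subset).1
      (mem_nhdsWithin_of_mem_nhds (t := Ici (sSup K)) (hopen.mem_nhds h))
    have h1 : (l + sSup K) / 2 ∈ K := hl' ⟨by linarith [mem_Ioi.1 hl], by linarith [mem_Ioi.1 hl]⟩
    linarith [le_csSup hba h1, mem_Ioi.1 hl]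
  have hEq : K = Ioo (sInf K) (sSup K) := by
    refine Subset.antisymm (fun y hy => ⟨?_, ?_⟩) hsub
    · exact lt_of_le_of_ne (csInf_le hbb hy) fun h => hinf (h ▸ hy)
    · exact lt_of_le_of_ne (le_csSup hba hy) fun h => hsup (h ▸ hy)
  have hxI : x ∈ Ioo (sInf K) (sSup K) := hEq ▸ hxK
  refine ⟨sInf K, sSup K, hxI.1.trans hxI.2, hEq,
    le_csInf ⟨x, hxK⟩ fun y hy => (hUab (hKU hy)).1.le,
    csSup_le ⟨x, hxK⟩ fun y hy => (hUab (hKU hy)).2.le, fun h => ?_, fun h => ?_⟩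
  · refine hinf (hmax (Ico (sInf K) (sSup K)) isPreconnected_Ico (Ioo_subset_Ico_self hxI) ?_
      ⟨le_rfl, hxI.1.trans hxI.2⟩)
    intro y hy
    rcases hy.1.eq_or_lt with h' | h'
    · exact h' ▸ h
    · exact hKU (hsub ⟨h', hy.2⟩)
  · refine hsup (hmax (Ioc (sInf K) (sSup K)) isPreconnected_Ioc (Ioo_subset_Ioc_self hxI) ?_
      ⟨hxI.1.trans hxI.2, le_rfl⟩)
    intro y hy
    rcases hy.2.eq_or_lt with h' | h'
    · exact h' ▸ h
    · exact hKU (hsub ⟨hy.1, h'⟩)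

lemma setIntegral_nonpos_of_components {a b : ℝ} {U : Set ℝ} {f : ℝ → ℝ} (hU : IsOpen U)
    (hUab : U ⊆ Ioo a b) (hf : IntegrableOn f U)
    (h : ∀ c d, c < d → a ≤ c → d ≤ b → Ioo c d ⊆ U → c ∉ U → d ∉ U →
      ∫ x in Ioo c d, f x ≤ 0) :
    ∫ x in U, f x ≤ 0 := by
  set S : Set (Set ℝ) := (fun x => connectedComponentIn U x) '' U with hS
  have hdisj : S.PairwiseDisjoint id := by
    rintro _ ⟨x, _, rfl⟩ _ ⟨y, _, rfl⟩ hne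
    refine Set.disjoint_left.2 fun z hzx hzy => hne ?_
    exact (connectedComponentIn_eq hzx).trans (connectedComponentIn_eq hzy).symm
  have hcount : S.Countable := by
    refine hdisj.countable_of_isOpen ?_ ?_
    · rintro _ ⟨x, _, rfl⟩
      exact hU.connectedComponentIn
    · rintro _ ⟨x, hx, rfl⟩
      exact ⟨x, mem_connectedComponentIn hx⟩
  have hUS : U = ⋃ s : S, (s : Set ℝ) := by
    ext x
    simp only [mem_iUnion]
    constructor
    · intro hx
      exact ⟨⟨_, ⟨x, hx, rfl⟩⟩, mem_connectedComponentIn hx⟩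
    · rintro ⟨⟨_, ⟨y, _, rfl⟩⟩, hx⟩
      exact connectedComponentIn_subset U y hx
  have : Countable S := hcount.to_subtype
  have hint : ∫ x in U, f x = ∑' s : S, ∫ x in (s : Set ℝ), f x := by
    conv_lhs => rw [hUS]
    refine integral_iUnion ?_ ?_ (hUS ▸ hf)
    · rintro ⟨_, ⟨x, _, rfl⟩⟩
      exact hU.connectedComponentIn.measurableSet
    · intro s t hst
      exact hdisj s.2 t.2 fun h => hst (Subtype.ext h)
  rw [hint]
  refine tsum_nonpos ?_
  rintro ⟨_, ⟨x, hx, rfl⟩⟩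
  obtain ⟨c, d, hcd, hEq, hac, hdb, hc, hd⟩ := exists_connectedComponentIn_eq_Ioo hU hUab hx
  simp only [hEq]
  exact h c d hcd hac hdb (hEq ▸ connectedComponentIn_subset U x) hc hd

/-! ### A rising sun lemma -/

/-- The rising sun set of `g` on `(a, b)`, modified so that, when `g a = 0` and `g b ≤ 0`, the
component starting at `a` also has the same value of `g` at its two endpoints: a point `x` is
shaded as soon as a later value of `g` exceeds `min (g x) 0`. -/
def risingSunSet (g : ℝ → ℝ) (a b : ℝ) : Set ℝ :=
  {x | x ∈ Ioo a b ∧ ∃ y ∈ Ioc x b, min (g x) 0 < g y}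

lemma isOpen_risingSunSet {g : ℝ → ℝ} (hg : Continuous g) (a b : ℝ) :
    IsOpen (risingSunSet g a b) := by
  have : risingSunSet g a b = Ioo a b ∩ ⋃ y ∈ Iic b, (Iio y ∩ {x | min (g x) 0 < g y}) := by
    ext x
    simp only [risingSunSet, mem_ofPred_eq, mem_inter_iff, mem_iUnion, mem_Ioc, mem_Iic, mem_Iio,
      exists_prop]
    refine and_congr_right fun _ => exists_congr fun y => ?_
    tauto
  rw [this]
  exact isOpen_Ioo.inter (isOpen_biUnion fun y _ =>
    isOpen_Iio.inter (isOpen_lt (hg.min continuous_const) continuous_const))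

/-- On every component of the rising sun set, `g` takes the same value at the two endpoints. -/
lemma eq_of_component_risingSunSet {g : ℝ → ℝ} (hg : Continuous g) {a b c d : ℝ}
    (ha : g a = 0) (hb : g b ≤ 0) (hcd : c < d) (hac : a ≤ c) (hdb : d ≤ b)
    (hsub : Ioo c d ⊆ risingSunSet g a b) (hc : c ∉ risingSunSet g a b)
    (hd : d ∉ risingSunSet g a b) : g d = g c := by
  have hout : ∀ x ∈ Ioo a b, x ∉ risingSunSet g a b → ∀ y ∈ Ioc x b, g y ≤ min (g x) 0 := by
    intro x hx hxU y hy
    by_contra hlt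
    exact hxU ⟨hx, y, hy, not_le.1 hlt⟩
  have hc' : ∀ y ∈ Ioc c b, a < c → g y ≤ min (g c) 0 := fun y hy h =>
    hout c ⟨h, hcd.trans_le hdb⟩ hc y hy
  have hd' : ∀ y ∈ Ioc d b, g y ≤ min (g d) 0 := fun y hy =>
    hout d ⟨hac.trans_lt hcd, hy.1.trans_le hy.2⟩ hd y hy
  have limit : ∀ u v B : ℝ, u < v → (∀ y ∈ Ioc u v, g y ≤ B) → g u ≤ B := by
    intro u v B huv H
    refine le_of_tendsto (hg.continuousAt.tendsto.mono_left (nhdsWithin_le_nhds (s := Ioi u))) ?_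
    filter_upwards [Ioc_mem_nhdsGT huv] with y hy using H y hy
  have hd0 : g d ≤ 0 := by
    rcases hdb.eq_or_lt with h | h
    · rw [h]; exact hb
    · exact limit d b 0 h fun y hy => (hd' y hy).trans (min_le_right _ _)
  have hc0 : g c ≤ 0 := by
    rcases hac.eq_or_lt with h | h
    · rw [← h, ha]
    · exact limit c b 0 (hcd.trans_le hdb) fun y hy => (hc' y hy h).trans (min_le_right _ _)
  refine le_antisymm ?_ ?_
  · rcases hac.eq_or_lt with h | h
    · rw [← h, ha]; exact hd0
    · exact (hc' d ⟨hcd, hdb⟩ h).trans (min_le_left _ _)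
  · have hx : ∀ x ∈ Ioo c d, min (g x) 0 ≤ g d := by
      intro x hx
      by_contra hlt
      rw [not_le] at hlt
      -- the last point `z` of `[x, d]` at which `g` is at least `min (g x) 0`
      have hcomp : IsCompact (Icc x d ∩ {z | min (g x) 0 ≤ g z}) :=
        isCompact_Icc.inter_right (isClosed_le continuous_const hg)
      obtain ⟨z, ⟨hzI, hz⟩, hzmax⟩ := hcomp.exists_isGreatest
        ⟨x, ⟨le_rfl, hx.2.le⟩, mem_ofPred_eq ▸ min_le_left (g x) 0⟩
      rw [mem_ofPred_eq] at hz
      have hzd : z < d := lt_of_le_of_ne hzI.2 fun h => by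
        rw [h] at hz
        exact absurd hz (not_le.2 hlt)
      obtain ⟨-, y, hy, hzy⟩ := hsub ⟨hx.1.trans_le hzI.1, hzd⟩
      have hμ : min (g x) 0 ≤ min (g z) 0 := le_min hz (min_le_right _ _)
      have hdy : d < y := by
        by_contra hyd
        have := hzmax ⟨⟨hzI.1.trans hy.1.le, not_lt.1 hyd⟩, (hμ.trans_lt hzy).le⟩
        exact absurd hy.1 (not_lt.2 this)
      have h1 := (hd' y ⟨hdy, hy.2⟩).trans (min_le_left _ _)
      linarith
    have h1 : min (g c) 0 ≤ g d := by
      refine le_of_tendsto (((hg.min continuous_const).continuousAt (x := c)).tendsto.mono_left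
        (nhdsWithin_le_nhds (s := Ioi c))) ?_
      filter_upwards [Ioo_mem_nhdsGT hcd] with y hy using hx y hy
    rwa [min_eq_left hc0] at h1

lemma deriv_nonpos_of_le_right {g : ℝ → ℝ} {g' x b : ℝ} (hg : HasDerivAt g g' x) (hxb : x < b)
    (h : ∀ y ∈ Ioc x b, g y ≤ g x) : g' ≤ 0 := by
  have ht := (hasDerivAt_iff_tendsto_slope.1 hg).mono_left
    (nhdsWithin_mono x (s := Ioi x) fun y hy => ne_of_gt (mem_Ioi.1 hy))
  refine le_of_tendsto ht ?_
  filter_upwards [Ioc_mem_nhdsGT hxb] with y hy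
  rw [slope_def_field]
  exact div_nonpos_of_nonpos_of_nonneg (by linarith [h y hy]) (by linarith [hy.1])

/-! ### Sets on which the mean is prescribed and the variance controlled -/

section Levels

variable {φ : ℝ → ℝ} {a b : ℝ}

/-- The primitive of `φ - α` which vanishes at `a`. -/
noncomputable def excess (φ : ℝ → ℝ) (a α x : ℝ) : ℝ := (∫ t in a..x, φ t) - α * (x - a)

lemma continuous_excess (hφ : Integrable φ) (a α : ℝ) : Continuous (excess φ a α) :=
  (intervalIntegral.continuous_primitive (fun _ _ => hφ.intervalIntegrable) a).sub
    (continuous_const.mul (continuous_id.sub continuous_const))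

lemma excess_left (φ : ℝ → ℝ) (a α : ℝ) : excess φ a α a = 0 := by simp [excess]

lemma excess_sub_excess (hφ : Integrable φ) (a α : ℝ) {c d : ℝ} (hcd : c ≤ d) :
    excess φ a α d - excess φ a α c = ∫ x in Ioo c d, (φ x - α) := by
  rw [← integral_Ioc_eq_integral_Ioo, ← intervalIntegral.integral_of_le hcd,
    intervalIntegral.integral_sub hφ.intervalIntegrable intervalIntegrable_const,
    ← intervalIntegral.integral_interval_sub_left (a := a) hφ.intervalIntegrable
      hφ.intervalIntegrable]
  simp only [excess, intervalIntegral.integral_const, smul_eq_mul]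
  ring

lemma risingSunSet_excess_anti (φ : ℝ → ℝ) (a b : ℝ) {α β : ℝ} (h : α ≤ β) :
    risingSunSet (excess φ a β) a b ⊆ risingSunSet (excess φ a α) a b := by
  rintro x ⟨hx, y, hy, hlt⟩
  refine ⟨hx, y, hy, ?_⟩
  have e : ∀ z, excess φ a α z = excess φ a β z + (β - α) * (z - a) := fun z => by
    simp only [excess]; ring
  have h0 : 0 ≤ (β - α) * (y - a) :=
    mul_nonneg (by linarith) (by linarith [hx.1, hy.1])
  have h1 : (β - α) * (x - a) ≤ (β - α) * (y - a) :=
    mul_le_mul_of_nonneg_left (by linarith [hy.1]) (by linarith)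
  rcases min_lt_iff.1 hlt with h2 | h2
  · exact min_lt_iff.2 (Or.inl (by rw [e, e y]; linarith))
  · exact min_lt_iff.2 (Or.inr (by rw [e]; linarith))

lemma ae_le_of_notMem_risingSunSet (hφ : Integrable φ) (a b α : ℝ) :
    ∀ᵐ x, x ∈ Ioo a b → x ∉ risingSunSet (excess φ a α) a b → φ x ≤ α := by
  filter_upwards [LocallyIntegrable.ae_hasDerivAt_integral hφ.locallyIntegrable] with x hx hxI hxU
  have hd : HasDerivAt (excess φ a α) (φ x - α) x := by
    have := (hx a).sub (((hasDerivAt_id x).sub_const a).const_mul α)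
    refine this.congr_deriv ?_
    simp
  have := deriv_nonpos_of_le_right hd hxI.2 fun y hy => by
    by_contra hlt
    exact hxU ⟨hxI, y, hy, (min_le_left _ _).trans_lt (not_le.1 hlt)⟩
  linarith

lemma setIntegral_sub_eq_zero (hφ : Integrable φ) {α : ℝ} (hα : excess φ a α b ≤ 0) :
    ∫ x in risingSunSet (excess φ a α) a b, (φ x - α) = 0 := by
  have hsub : risingSunSet (excess φ a α) a b ⊆ Ioo a b := fun x hx => hx.1
  have hint : IntegrableOn (fun x => φ x - α) (Ioo a b) :=
    hφ.integrableOn.sub (integrableOn_const (by simp))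
  have hopen := isOpen_risingSunSet (continuous_excess hφ a α) a b
  have hz : ∀ c d, c < d → a ≤ c → d ≤ b → Ioo c d ⊆ risingSunSet (excess φ a α) a b →
      c ∉ risingSunSet (excess φ a α) a b → d ∉ risingSunSet (excess φ a α) a b →
      ∫ x in Ioo c d, (φ x - α) = 0 := by
    intro c d hcd hac hdb h1 h2 h3
    rw [← excess_sub_excess hφ a α hcd.le, eq_of_component_risingSunSet
      (continuous_excess hφ a α) (excess_left φ a α) hα hcd hac hdb h1 h2 h3, sub_self]
  refine le_antisymm ?_ ?_
  · exact setIntegral_nonpos_of_components hopen hsub (hint.mono_set hsub)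
      fun c d hcd hac hdb h1 h2 h3 => (hz c d hcd hac hdb h1 h2 h3).le
  · have := setIntegral_nonpos_of_components hopen hsub (hint.mono_set hsub).neg
      fun c d hcd hac hdb h1 h2 h3 => by
        simp only [Pi.neg_apply, integral_neg, hz c d hcd hac hdb h1 h2 h3, neg_zero, le_refl]
    simp only [Pi.neg_apply, integral_neg] at this
    linarith

/-- The oscillation of `φ` on `(a, b)` is at most `ε`: the mean of `(φ - α)²` over every
subinterval on which `φ` has mean `α` is at most `ε²`. -/
def OscLE (φ : ℝ → ℝ) (a b ε : ℝ) : Prop :=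
  ∀ c d α : ℝ, a ≤ c → c < d → d ≤ b → ∫ x in Ioo c d, (φ x - α) = 0 →
    ∫ x in Ioo c d, (φ x - α) ^ 2 ≤ ε ^ 2 * (d - c)

lemma integrableOn_sub_sq (hφ : Integrable φ) (hφ2 : IntegrableOn (fun x => φ x ^ 2) (Ioo a b))
    (α : ℝ) : IntegrableOn (fun x => (φ x - α) ^ 2) (Ioo a b) := by
  have : (fun x => (φ x - α) ^ 2) = fun x => φ x ^ 2 - 2 * α * φ x + α ^ 2 := by
    ext x; ring
  rw [this]
  exact (hφ2.sub (hφ.integrableOn.const_mul _)).add (integrableOn_const (by simp))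

lemma setIntegral_sub_sq_le (hφ : Integrable φ)
    (hφ2 : IntegrableOn (fun x => φ x ^ 2) (Ioo a b)) {ε : ℝ} (hosc : OscLE φ a b ε)
    {α : ℝ} (hα : excess φ a α b ≤ 0) :
    ∫ x in risingSunSet (excess φ a α) a b, (φ x - α) ^ 2 ≤
      ε ^ 2 * volume.real (risingSunSet (excess φ a α) a b) := by
  have hsub : risingSunSet (excess φ a α) a b ⊆ Ioo a b := fun x hx => hx.1
  have hsq := integrableOn_sub_sq hφ hφ2 α
  have hcon : IntegrableOn (fun _ => ε ^ 2) (Ioo a b) := integrableOn_const (by simp)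
  have hopen := isOpen_risingSunSet (continuous_excess hφ a α) a b
  have := setIntegral_nonpos_of_components (f := fun x => (φ x - α) ^ 2 - ε ^ 2) hopen hsub
    ((hsq.sub hcon).mono_set hsub) fun c d hcd hac hdb h1 h2 h3 => by
      have hI : Ioo c d ⊆ Ioo a b := Ioo_subset_Ioo hac hdb
      rw [integral_sub (hsq.mono_set hI) (hcon.mono_set hI), setIntegral_const]
      have hm : ∫ x in Ioo c d, (φ x - α) = 0 := by
        rw [← excess_sub_excess hφ a α hcd.le, eq_of_component_risingSunSet
          (continuous_excess hφ a α) (excess_left φ a α) hα hcd hac hdb h1 h2 h3, sub_self]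
      have := hosc c d α hac hcd hdb hm
      rw [Real.volume_real_Ioo_of_le hcd.le, smul_eq_mul]
      linarith
  rw [integral_sub (hsq.mono_set hsub) (hcon.mono_set hsub), setIntegral_const, smul_eq_mul] at this
  linarith

end Levels

/-! ### The exponential integral -/

section Exp

variable {φ : ℝ → ℝ} {a b : ℝ}

lemma integrableOn_tangentParabola (hφ : Integrable φ)
    (hφ2 : IntegrableOn (fun x => φ x ^ 2) (Ioo a b)) (δ c : ℝ) :
    IntegrableOn (fun x => tangentParabola δ c (φ x)) (Ioo a b) := by
  have h1 : IntegrableOn (fun x => 1 + (φ x - c)) (Ioo a b) :=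
    (integrableOn_const (by simp)).add (hφ.integrableOn.sub (integrableOn_const (by simp)))
  exact (h1.add ((integrableOn_sub_sq hφ hφ2 c).div_const _)).const_mul _

/-- The mean of a tangent parabola depends only on the mean and the variance. -/
lemma setIntegral_tangentParabola (hφ : Integrable φ)
    (hφ2 : IntegrableOn (fun x => φ x ^ 2) (Ioo a b)) {A : Set ℝ} (hA : A ⊆ Ioo a b) {α : ℝ}
    (hmean : ∫ x in A, (φ x - α) = 0) (δ c : ℝ) :
    ∫ x in A, tangentParabola δ c (φ x) =
      Real.exp c * ((1 + (α - c)) * volume.real A +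
        ((∫ x in A, (φ x - α) ^ 2) + (α - c) ^ 2 * volume.real A) / (2 * (1 - δ))) := by
  have hsq := (integrableOn_sub_sq hφ hφ2 α).mono_set hA
  have hvol : volume A ≠ ∞ := ne_top_of_le_ne_top (by simp) (measure_mono hA)
  have hlin : IntegrableOn (fun x => φ x - α) A :=
    hφ.integrableOn.sub (integrableOn_const hvol)
  have hexp : ∀ x, tangentParabola δ c (φ x) =
      Real.exp c * (1 + (α - c) + (α - c) ^ 2 / (2 * (1 - δ))) +
        Real.exp c * (1 + 2 * (α - c) / (2 * (1 - δ))) * (φ x - α) +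
        Real.exp c / (2 * (1 - δ)) * (φ x - α) ^ 2 := fun x => by
    simp only [tangentParabola]; ring
  simp only [hexp]
  have i1 : IntegrableOn (fun _ : ℝ =>
      Real.exp c * (1 + (α - c) + (α - c) ^ 2 / (2 * (1 - δ)))) A := integrableOn_const hvol
  have i2 : IntegrableOn (fun x =>
      Real.exp c * (1 + 2 * (α - c) / (2 * (1 - δ))) * (φ x - α)) A := hlin.const_mul _
  have i3 : IntegrableOn (fun x => Real.exp c / (2 * (1 - δ)) * (φ x - α) ^ 2) A :=
    hsq.const_mul _
  have i12 : IntegrableOn (fun x =>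
      Real.exp c * (1 + (α - c) + (α - c) ^ 2 / (2 * (1 - δ))) +
        Real.exp c * (1 + 2 * (α - c) / (2 * (1 - δ))) * (φ x - α)) A := i1.add i2
  rw [integral_add i12 i3, integral_add i1 i2, setIntegral_const, smul_eq_mul,
    integral_const_mul, integral_const_mul, hmean]
  ring

/-- If `φ` has mean `α` and variance at most `δ² - h²` on `A`, then the integral over `A` of the
tangent parabola at `c` decreases when `c` moves from `α - δ` to `α - δ + h`. -/
lemma setIntegral_tangentParabola_shift_le (hφ : Integrable φ)
    (hφ2 : IntegrableOn (fun x => φ x ^ 2) (Ioo a b)) {A : Set ℝ} (hA : A ⊆ Ioo a b) {α δ h : ℝ}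
    (h0 : 0 ≤ δ) (h1 : δ < 1) (hh : 0 ≤ h) (hmean : ∫ x in A, (φ x - α) = 0)
    (hvar : ∫ x in A, (φ x - α) ^ 2 ≤ (δ ^ 2 - h ^ 2) * volume.real A) :
    ∫ x in A, tangentParabola δ (α + h - δ) (φ x) ≤
      ∫ x in A, tangentParabola δ (α - δ) (φ x) := by
  rw [setIntegral_tangentParabola hφ hφ2 hA hmean, setIntegral_tangentParabola hφ hφ2 hA hmean]
  have hS : 0 ≤ ∫ x in A, (φ x - α) ^ 2 := integral_nonneg fun x => sq_nonneg _
  generalize (∫ x in A, (φ x - α) ^ 2) = S at hS hvar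
  rcases (measureReal_nonneg (μ := volume) (s := A)).eq_or_lt with hN | hN
  · rw [← hN] at hvar ⊢
    have : S = 0 := le_antisymm (by simpa using hvar) hS
    simp [this]
  · generalize volume.real A = N at hN hvar
    have key := mean_tangentParabola_shift_le (α := α) h0 h1 hh (div_nonneg hS hN.le)
      ((div_le_iff₀ hN).2 hvar)
    have := mul_le_mul_of_nonneg_right key hN.le
    have hδ : 1 - δ ≠ 0 := by linarith
    have e : ∀ y : ℝ, (1 + y + (S / N + y ^ 2) / (2 * (1 - δ))) * N =
        (1 + y) * N + (S + y ^ 2 * N) / (2 * (1 - δ)) := fun y => by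
      field_simp
    rw [mul_assoc, mul_assoc, e, e] at this
    rwa [show α - (α + h - δ) = δ - h by ring, show α - (α - δ) = δ by ring]

/-- The quantitative core: if `φ` has mean `m` on `(a, b)` and oscillation at most `ε < δ < 1`, then
`e^φ` has mean at most `e^(m - δ) / (1 - δ)`. -/
lemma setLIntegral_exp_le (hab : a < b) (hφ : Integrable φ)
    (hφ2 : IntegrableOn (fun x => φ x ^ 2) (Ioo a b)) {ε δ : ℝ} (hosc : OscLE φ a b ε)
    (hε : 0 ≤ ε) (hεδ : ε < δ) (h1 : δ < 1) {m : ℝ} (hm : ∫ x in Ioo a b, (φ x - m) = 0) :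
    ∫⁻ x in Ioo a b, ENNReal.ofReal (Real.exp (φ x)) ≤
      ENNReal.ofReal ((b - a) * (Real.exp (m - δ) / (1 - δ))) := by
  have h0 : 0 ≤ δ := hε.trans hεδ.le
  have hpos : 0 < δ ^ 2 - ε ^ 2 := by nlinarith
  -- the step between consecutive levels, for which the parabolas still decrease
  set h := Real.sqrt (δ ^ 2 - ε ^ 2) with hh
  have hh0 : 0 < h := Real.sqrt_pos.2 hpos
  have hh2 : δ ^ 2 - h ^ 2 = ε ^ 2 := by rw [hh, Real.sq_sqrt hpos.le]; ring
  set lev : ℕ → ℝ := fun n => m + n * h with hlev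
  -- the rising sun set of level `m` may miss points where `φ = m`, so `A 0` is the whole interval
  set A : ℕ → Set ℝ := fun n =>
    if n = 0 then Ioo a b else risingSunSet (excess φ a (lev n)) a b with hAdef
  have hA0 : A 0 = Ioo a b := by simp [hAdef]
  have hAs : ∀ n, A (n + 1) = risingSunSet (excess φ a (lev (n + 1))) a b := fun n => by
    simp [hAdef]
  have hlevs : ∀ n, lev (n + 1) = lev n + h := fun n => by simp only [hlev]; push_cast; ring
  have hlev0 : lev 0 = m := by simp [hlev]
  have hexc : ∀ n, excess φ a (lev n) b ≤ 0 := by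
    intro n
    have e1 := excess_sub_excess hφ a m hab.le
    rw [hm, excess_left] at e1
    have e2 : excess φ a (lev n) b = excess φ a m b - n * h * (b - a) := by
      simp only [excess, hlev]; ring
    have : 0 ≤ n * h * (b - a) :=
      mul_nonneg (mul_nonneg n.cast_nonneg hh0.le) (sub_nonneg.2 hab.le)
    linarith
  have hAI : ∀ n, A n ⊆ Ioo a b := by
    intro n
    cases n with
    | zero => rw [hA0]
    | succ n => rw [hAs]; exact fun x hx => hx.1
  have hAm : ∀ n, MeasurableSet (A n) := by
    intro n
    cases n with
    | zero => rw [hA0]; exact measurableSet_Ioo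
    | succ n => rw [hAs]; exact (isOpen_risingSunSet (continuous_excess hφ _ _) _ _).measurableSet
  have hAanti : ∀ n, A (n + 1) ⊆ A n := by
    intro n
    cases n with
    | zero => rw [hA0]; exact hAI 1
    | succ n =>
      rw [hAs, hAs]
      exact risingSunSet_excess_anti φ a b (by rw [hlevs (n + 1)]; linarith)
  have hmean : ∀ n, ∫ x in A n, (φ x - lev n) = 0 := by
    intro n
    cases n with
    | zero => rw [hA0, hlev0]; exact hm
    | succ n => rw [hAs]; exact setIntegral_sub_eq_zero hφ (hexc _)
  have hvar : ∀ n, ∫ x in A n, (φ x - lev n) ^ 2 ≤ ε ^ 2 * volume.real (A n) := by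
    intro n
    cases n with
    | zero =>
      rw [hA0, hlev0, Real.volume_real_Ioo_of_le hab.le]
      exact hosc a b m le_rfl hab le_rfl hm
    | succ n => rw [hAs]; exact setIntegral_sub_sq_le hφ hφ2 hosc (hexc _)
  set E : ℝ → ℝ≥0∞ := fun x => ENNReal.ofReal (Real.exp (φ x)) with hE
  set T : ℕ → ℝ → ℝ≥0∞ := fun n x => ENNReal.ofReal (tangentParabola δ (lev n - δ) (φ x)) with hT
  have hTint : ∀ n k, ∫⁻ x in A n, T k x =
      ENNReal.ofReal (∫ x in A n, tangentParabola δ (lev k - δ) (φ x)) := fun n k =>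
    (ofReal_integral_eq_lintegral_ofReal
      ((integrableOn_tangentParabola hφ hφ2 δ _).mono_set (hAI n))
      (Eventually.of_forall fun x => tangentParabola_nonneg h0 h1 _ _)).symm
  have hshift : ∀ n, ∫⁻ x in A n, T (n + 1) x ≤ ∫⁻ x in A n, T n x := by
    intro n
    rw [hTint, hTint, hlevs]
    refine ENNReal.ofReal_le_ofReal (setIntegral_tangentParabola_shift_le hφ hφ2 (hAI n) h0 h1
      hh0.le (hmean n) ?_)
    rw [hh2]; exact hvar n
  have hbelow : ∀ n, ∫⁻ x in A n \ A (n + 1), E x ≤ ∫⁻ x in A n \ A (n + 1), T (n + 1) x := by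
    intro n
    refine setLIntegral_mono_ae' ((hAm n).diff (hAm (n + 1))) ?_
    filter_upwards [ae_le_of_notMem_risingSunSet hφ a b (lev (n + 1))] with x hx hxA
    refine ENNReal.ofReal_le_ofReal (exp_le_tangentParabola h0 h1 ?_)
    have := hx (hAI n hxA.1) (by rw [← hAs]; exact hxA.2)
    linarith
  -- on `A n` pass to the parabola of level `n + 1`, which then dominates `e^φ` off `A (n + 1)`
  have hind : ∀ n, (∫⁻ x in Ioo a b \ A n, E x) + (∫⁻ x in A n, T n x) ≤ (∫⁻ x in A 0, T 0 x) := by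
    intro n
    induction n with
    | zero => simp [hA0]
    | succ n ih =>
      refine le_trans ?_ ih
      have hsplit : Ioo a b \ A (n + 1) = (Ioo a b \ A n) ∪ (A n \ A (n + 1)) := by
        ext x
        have := @hAanti n x
        have := @hAI n x
        simp only [Set.mem_sdiff, mem_union]
        tauto
      calc (∫⁻ x in Ioo a b \ A (n + 1), E x) + (∫⁻ x in A (n + 1), T (n + 1) x)
          ≤ ((∫⁻ x in Ioo a b \ A n, E x) + (∫⁻ x in A n \ A (n + 1), E x)) +
              (∫⁻ x in A (n + 1), T (n + 1) x) := by
            rw [hsplit]; gcongr (?_ + _); exact lintegral_union_le _ _ _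
        _ ≤ ((∫⁻ x in Ioo a b \ A n, E x) + (∫⁻ x in A n \ A (n + 1), T (n + 1) x)) +
              (∫⁻ x in A (n + 1), T (n + 1) x) := by
            gcongr (_ + ?_) + _
            exact hbelow n
        _ = (∫⁻ x in Ioo a b \ A n, E x) + (∫⁻ x in A n, T (n + 1) x) := by
            rw [add_assoc, ← lintegral_inter_add_sdiff (T (n + 1)) (A n) (hAm (n + 1)),
              inter_eq_right.2 (hAanti n), add_comm (∫⁻ x in A (n + 1), T (n + 1) x)]
        _ ≤ _ := by gcongr (_ + ?_); exact hshift n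
  have hnull : volume (⋂ n, A n) = 0 := by
    have hfin : volume (⋂ n, A n) ≠ ∞ :=
      ne_top_of_le_ne_top (by simp) (measure_mono ((iInter_subset A 0).trans (hAI 0)))
    by_contra hne
    have hv : 0 < volume.real (⋂ n, A n) := ENNReal.toReal_pos hne hfin
    -- the integral of `φ` over `A n` is `lev n` times the length of `A n`
    have hbound : ∀ n, lev n * volume.real (A n) ≤ ∫ x, |φ x| := by
      intro n
      have hvol : volume (A n) ≠ ∞ := ne_top_of_le_ne_top (by simp) (measure_mono (hAI n))
      have := hmean n
      rw [integral_sub hφ.integrableOn (integrableOn_const hvol), setIntegral_const,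
        smul_eq_mul] at this
      have h2 : ∫ x in A n, φ x ≤ ∫ x in A n, |φ x| :=
        integral_mono hφ.integrableOn hφ.abs.integrableOn fun x => le_abs_self _
      have h3 : ∫ x in A n, |φ x| ≤ ∫ x, |φ x| :=
        setIntegral_le_integral hφ.abs (Eventually.of_forall fun x => abs_nonneg _)
      linarith
    obtain ⟨n, hn⟩ := exists_nat_gt
      ((max 0 ((∫ x, |φ x|) / volume.real (⋂ n, A n)) - m) / h)
    rw [div_lt_iff₀ hh0] at hn
    have hn1 : max 0 ((∫ x, |φ x|) / volume.real (⋂ n, A n)) < lev n := by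
      simp only [hlev]; linarith
    have hn2 : (∫ x, |φ x|) < lev n * volume.real (⋂ n, A n) :=
      (div_lt_iff₀ hv).1 ((le_max_right _ _).trans_lt hn1)
    have hn3 : volume.real (⋂ n, A n) ≤ volume.real (A n) :=
      measureReal_mono (iInter_subset A n)
        (ne_top_of_le_ne_top (by simp) (measure_mono (hAI n)))
    have hn4 := mul_le_mul_of_nonneg_left hn3 ((le_max_left _ _).trans hn1.le)
    linarith [hbound n]
  have hunion : ∫⁻ x in Ioo a b, E x = ∫⁻ x in ⋃ n, Ioo a b \ A n, E x := by
    rw [← sdiff_iInter]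
    exact setLIntegral_congr (sdiff_null_ae_eq_self hnull).symm
  -- the initial parabola has the stated mean when the variance is `δ ^ 2`
  have hF0 : ∫⁻ x in A 0, T 0 x ≤ ENNReal.ofReal ((b - a) * (Real.exp (m - δ) / (1 - δ))) := by
    rw [hTint, setIntegral_tangentParabola hφ hφ2 (hAI 0) (hmean 0)]
    have hv0 := hvar 0
    rw [hlev0, hA0, Real.volume_real_Ioo_of_le hab.le] at hv0 ⊢
    refine ENNReal.ofReal_le_ofReal ?_
    have hδ : 0 < 1 - δ := by linarith
    have e : (b - a) * (Real.exp (m - δ) / (1 - δ)) = Real.exp (m - δ) *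
        ((1 + δ) * (b - a) + (δ ^ 2 * (b - a) + δ ^ 2 * (b - a)) / (2 * (1 - δ))) := by
      field_simp; ring
    rw [e, show m - (m - δ) = δ by ring]
    have hle : ε ^ 2 * (b - a) ≤ δ ^ 2 * (b - a) :=
      mul_le_mul_of_nonneg_right (by linarith) (by linarith)
    gcongr
    exact hv0.trans hle
  rw [hunion, setLIntegral_iUnion_of_directed]
  · exact iSup_le fun n => (le_self_add.trans (hind n)).trans hF0
  · exact (monotone_nat_of_le_succ fun n => sdiff_subset_sdiff_right (hAanti n)).directed_le

end Exp

/-! ### The logarithm -/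

/-- This form exhibits `x log² x` as a continuous function up to `0`. -/
lemma mul_log_sq_eq {x : ℝ} (hx : 0 ≤ x) :
    x * Real.log x ^ 2 = 4 * (Real.sqrt x * Real.log (Real.sqrt x)) ^ 2 := by
  rw [Real.log_sqrt hx, mul_pow, Real.sq_sqrt hx]
  ring

lemma continuousOn_mul_log_sq : ContinuousOn (fun x : ℝ => x * Real.log x ^ 2) (Ici 0) := by
  have h : Continuous fun x : ℝ => 4 * (Real.sqrt x * Real.log (Real.sqrt x)) ^ 2 :=
    continuous_const.mul ((Real.continuous_mul_log.comp Real.continuous_sqrt).pow 2)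
  exact h.continuousOn.congr fun x hx => mul_log_sq_eq hx

lemma integral_log_sq {c d : ℝ} (hc : 0 ≤ c) (hcd : c < d) :
    IntervalIntegrable (fun x => Real.log x ^ 2) volume c d ∧
    ∫ x in c..d, Real.log x ^ 2 =
      d * Real.log d ^ 2 - c * Real.log c ^ 2 - 2 * (d * Real.log d - c * Real.log c) +
        2 * (d - c) := by
  set G : ℝ → ℝ := fun x => x * Real.log x ^ 2 - 2 * (x * Real.log x) + 2 * x with hG
  have hcont : ContinuousOn G (Icc c d) :=
    (((continuousOn_mul_log_sq.mono fun x hx => hc.trans hx.1).sub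
      (continuous_const.mul Real.continuous_mul_log).continuousOn).add
      (continuous_const.mul continuous_id).continuousOn)
  have hder : ∀ x ∈ Ioo c d, HasDerivAt G (Real.log x ^ 2) x := by
    intro x hx
    have hx0 : x ≠ 0 := (hc.trans_lt hx.1).ne'
    have h1 := (hasDerivAt_id x).mul ((Real.hasDerivAt_log hx0).pow 2)
    have h2 := ((hasDerivAt_id x).mul (Real.hasDerivAt_log hx0)).const_mul 2
    refine ((h1.sub h2).add ((hasDerivAt_id x).const_mul 2)).congr_deriv ?_
    simp
    field_simp
    ring
  have hint : IntervalIntegrable (fun x => Real.log x ^ 2) volume c d :=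
    (intervalIntegrable_iff_integrableOn_Ioc_of_le hcd.le).2
      (intervalIntegral.integrableOn_deriv_of_nonneg hcont hder fun x _ => sq_nonneg _)
  refine ⟨hint, ?_⟩
  rw [intervalIntegral.integral_eq_sub_of_hasDerivAt_of_le hcd.le hcont hder hint]
  simp only [hG]
  ring

/-- The mean oscillation of the logarithm on any interval of the positive half-line is at
most `1`; for `c = 0` it is equal to `1`. -/
lemma integral_log_sub_sq_le {c d μ : ℝ} (hc : 0 ≤ c) (hcd : c < d)
    (hμ : μ * (d - c) = ∫ x in c..d, Real.log x) :
    IntervalIntegrable (fun x => (Real.log x - μ) ^ 2) volume c d ∧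
    ∫ x in c..d, (Real.log x - μ) ^ 2 ≤ d - c := by
  obtain ⟨hint, h2⟩ := integral_log_sq hc hcd
  have hlog : IntervalIntegrable Real.log volume c d := intervalIntegral.intervalIntegrable_log'
  have e : (fun x => (Real.log x - μ) ^ 2) =
      fun x => (Real.log x ^ 2 - 2 * μ * Real.log x) + μ ^ 2 := by
    ext x; ring
  have hi1 := hlog.const_mul (2 * μ)
  have hi2 : IntervalIntegrable (fun _ : ℝ => μ ^ 2) volume c d := intervalIntegrable_const
  rw [e]
  refine ⟨(hint.sub hi1).add hi2, ?_⟩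
  rw [intervalIntegral.integral_add (hint.sub hi1) hi2, intervalIntegral.integral_sub hint hi1,
    intervalIntegral.integral_const_mul, intervalIntegral.integral_const, h2, ← hμ, smul_eq_mul]
  rw [integral_log] at hμ
  have hL : 0 < d - c := by linarith
  set C := Real.log c
  set D := Real.log d
  refine le_of_mul_le_mul_left ?_ hL
  have hid : (d - c) * (d * D ^ 2 - c * C ^ 2 - 2 * (d * D - c * C) + 2 * (d - c)
      - 2 * μ * (μ * (d - c)) + (d - c) * μ ^ 2) =
      (d - c) * (d * D ^ 2 - c * C ^ 2 - 2 * (d * D - c * C) + 2 * (d - c))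
        - (μ * (d - c)) ^ 2 := by ring
  rw [hid, hμ]
  have : 0 ≤ d * c * (D - C) ^ 2 := mul_nonneg (mul_nonneg (by linarith) hc) (sq_nonneg _)
  linarith

/-- The extremal function `-ε log (x - a)`. -/
noncomputable def logExtremal (a ε x : ℝ) : ℝ := -ε * Real.log (x - a)

lemma integral_logExtremal (a ε c d : ℝ) :
    ∫ x in c..d, logExtremal a ε x = -ε * ∫ x in (c - a)..(d - a), Real.log x := by
  simp only [logExtremal]
  rw [intervalIntegral.integral_const_mul, intervalIntegral.integral_comp_sub_right Real.log a]

lemma intervalIntegrable_logExtremal (a ε c d : ℝ) :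
    IntervalIntegrable (logExtremal a ε) volume c d := by
  have h : IntervalIntegrable Real.log volume (c - a) (d - a) :=
    intervalIntegral.intervalIntegrable_log'
  have h2 := (h.comp_sub_right a).const_mul (-ε)
  rw [sub_add_cancel, sub_add_cancel] at h2
  exact h2

lemma setAverage_Icc_eq {c d : ℝ} (hcd : c < d) (f : ℝ → ℝ) :
    ⨍ x in Icc c d, f x = (d - c)⁻¹ * ∫ x in c..d, f x := by
  rw [setAverage_eq, Real.volume_real_Icc_of_le hcd.le, integral_Icc_eq_integral_Ioc,
    intervalIntegral.integral_of_le hcd.le, smul_eq_mul]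

lemma logExtremal_mem_BMOBall {a b ε : ℝ} (hab : a < b) (hε : 0 ≤ ε) :
    logExtremal a ε ∈ BMOBall a b ε := by
  have hnorm : bmoNorm a b (logExtremal a ε) ≤ ENNReal.ofReal ε := by
    have hsup : (⨆ (c : ℝ) (d : ℝ) (_ : a ≤ c ∧ c < d ∧ d ≤ b),
        ⨍⁻ x in Icc c d, ‖logExtremal a ε x - ⨍ y in Icc c d, logExtremal a ε y‖ₑ ^ 2 ∂volume) ≤
        ENNReal.ofReal ε ^ 2 := by
      refine iSup_le fun c => iSup_le fun d => iSup_le fun ⟨hac, hcd, _⟩ => ?_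
      have hL : 0 < d - c := by linarith
      set μ : ℝ := (d - c)⁻¹ * ∫ x in (c - a)..(d - a), Real.log x with hμ
      have hμ' : μ * ((d - a) - (c - a)) = ∫ x in (c - a)..(d - a), Real.log x := by
        rw [hμ]; field_simp; ring
      obtain ⟨hi, hle⟩ := integral_log_sub_sq_le (by linarith) (by linarith) hμ'
      have hav : ⨍ y in Icc c d, logExtremal a ε y = -ε * μ := by
        rw [setAverage_Icc_eq hcd, integral_logExtremal, hμ]; ring
      have hi' : IntervalIntegrable (fun x => ε ^ 2 * (Real.log (x - a) - μ) ^ 2) volume c d := by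
        simpa using (hi.comp_sub_right a).const_mul (ε ^ 2)
      have hle' : ∫ x in c..d, ε ^ 2 * (Real.log (x - a) - μ) ^ 2 ≤ ε ^ 2 * (d - c) := by
        rw [intervalIntegral.integral_const_mul,
          intervalIntegral.integral_comp_sub_right (fun x => (Real.log x - μ) ^ 2) a]
        refine mul_le_mul_of_nonneg_left ?_ (sq_nonneg ε)
        linarith
      have hpt : ∀ x, ‖logExtremal a ε x - -ε * μ‖ₑ ^ 2 =
          ENNReal.ofReal (ε ^ 2 * (Real.log (x - a) - μ) ^ 2) := fun x => by
        rw [Real.enorm_eq_ofReal_abs, ← ENNReal.ofReal_pow (abs_nonneg _), sq_abs]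
        congr 1
        simp only [logExtremal]; ring
      rw [hav, setLAverage_eq, Real.volume_Icc]
      simp only [hpt]
      rw [← ofReal_integral_eq_lintegral_ofReal
          (((intervalIntegrable_iff_integrableOn_Icc_of_le hcd.le).1 hi'))
          (Eventually.of_forall fun x => by positivity),
        integral_Icc_eq_integral_Ioc, ← intervalIntegral.integral_of_le hcd.le,
        ← ENNReal.ofReal_div_of_pos hL, ← ENNReal.ofReal_pow hε]
      exact ENNReal.ofReal_le_ofReal ((div_le_iff₀ hL).2 hle')
    calc bmoNorm a b (logExtremal a ε) ≤ (ENNReal.ofReal ε ^ 2) ^ (1 / 2 : ℝ) :=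
          ENNReal.rpow_le_rpow hsup (by norm_num)
      _ = ENNReal.ofReal ε := by
          rw [← ENNReal.rpow_natCast, ← ENNReal.rpow_mul]; norm_num
  exact ⟨⟨(intervalIntegrable_iff_integrableOn_Icc_of_le hab.le).1
    (intervalIntegrable_logExtremal a ε a b), hnorm.trans_lt ENNReal.ofReal_lt_top⟩, hnorm⟩

lemma setAverage_logExtremal {a b : ℝ} (hab : a < b) (ε : ℝ) :
    ⨍ x in Icc a b, logExtremal a ε x = ε - ε * Real.log (b - a) := by
  have : b - a ≠ 0 := by linarith
  rw [setAverage_Icc_eq hab, integral_logExtremal, integral_log]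
  simp only [sub_self, zero_mul]
  field_simp
  ring

lemma setAverage_exp_logExtremal {a b ε : ℝ} (hab : a < b) (h1 : ε < 1) :
    ⨍ x in Icc a b, Real.exp (logExtremal a ε x) =
      Real.exp (-ε * Real.log (b - a)) / (1 - ε) := by
  have hL : 0 < b - a := by linarith
  have h2 : 1 - ε ≠ 0 := by linarith
  have hcongr : ∫ x in a..b, Real.exp (logExtremal a ε x) = ∫ x in a..b, (x - a) ^ (-ε) := by
    rw [intervalIntegral.integral_of_le hab.le, intervalIntegral.integral_of_le hab.le]
    refine setIntegral_congr_fun measurableSet_Ioc fun x hx => ?_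
    have : 0 < x - a := by linarith [hx.1]
    simp only [logExtremal]
    rw [Real.rpow_def_of_pos this, mul_comm]
  rw [setAverage_Icc_eq hab, hcongr,
    intervalIntegral.integral_comp_sub_right (fun x => x ^ (-ε)) a,
    integral_rpow (Or.inl (by linarith)), sub_self, Real.zero_rpow (by linarith), sub_zero,
    Real.rpow_add hL, Real.rpow_one, Real.rpow_def_of_pos hL, mul_comm (Real.log _),
    show -ε + 1 = 1 - ε by ring]
  field_simp

lemma not_integrableOn_exp_logExtremal_one {a b : ℝ} (hab : a < b) :
    ¬ IntegrableOn (fun x => Real.exp (logExtremal a 1 x)) (Icc a b) := by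
  intro h
  have h2 : IntervalIntegrable (fun x => (x - a)⁻¹) volume a b := by
    rw [intervalIntegrable_iff_integrableOn_Ioc_of_le hab.le]
    refine (h.mono_set Ioc_subset_Icc_self).congr_fun (fun x hx => ?_) measurableSet_Ioc
    have : 0 < x - a := by linarith [hx.1]
    simp only [logExtremal]
    rw [neg_one_mul, Real.exp_neg, Real.exp_log this]
  rcases intervalIntegrable_sub_inv_iff.1 h2 with h3 | h3
  · exact hab.ne h3
  · exact h3 left_mem_uIcc

/-! ### Sharp constants -/

lemma BMOBall.integral_sub_average_sq_le {a b ε : ℝ} {φ : ℝ → ℝ} (hφ : φ ∈ BMOBall a b ε)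
    (hε : 0 ≤ ε) {c d : ℝ} (hac : a ≤ c) (hcd : c < d) (hdb : d ≤ b) :
    IntegrableOn (fun x => (φ x - ⨍ y in Icc c d, φ y) ^ 2) (Icc c d) ∧
      ∫ x in Icc c d, (φ x - ⨍ y in Icc c d, φ y) ^ 2 ≤ ε ^ 2 * (d - c) := by
  obtain ⟨⟨hint, -⟩, hnorm⟩ := hφ
  have hL : 0 < d - c := by linarith
  set μ := ⨍ y in Icc c d, φ y with hμ
  have hle : ⨍⁻ x in Icc c d, ‖φ x - μ‖ₑ ^ 2 ∂volume ≤ ENNReal.ofReal (ε ^ 2) := by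
    have h1 : ⨍⁻ x in Icc c d, ‖φ x - μ‖ₑ ^ 2 ∂volume ≤ bmoNorm a b φ ^ (2 : ℝ) := by
      rw [bmoNorm, ← ENNReal.rpow_mul]
      norm_num
      exact le_iSup_of_le c (le_iSup_of_le d (le_iSup_of_le ⟨hac, hcd, hdb⟩ le_rfl))
    refine h1.trans ((ENNReal.rpow_le_rpow hnorm (by norm_num)).trans ?_)
    rw [ENNReal.ofReal_rpow_of_nonneg hε (by norm_num)]
    norm_num
  rw [setLAverage_eq, Real.volume_Icc, ENNReal.div_le_iff (by simpa using hcd) (by simp),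
    ← ENNReal.ofReal_mul (sq_nonneg ε)] at hle
  have hpt : ∀ x, ‖φ x - μ‖ₑ ^ 2 = ENNReal.ofReal ((φ x - μ) ^ 2) := fun x => by
    rw [Real.enorm_eq_ofReal_abs, ← ENNReal.ofReal_pow (abs_nonneg _), sq_abs]
  simp only [hpt] at hle
  have hmeas : AEStronglyMeasurable (fun x => (φ x - μ) ^ 2) (volume.restrict (Icc c d)) :=
    ((hint.mono_set (Icc_subset_Icc hac hdb)).aestronglyMeasurable.sub
      aestronglyMeasurable_const).pow 2
  have hsq : IntegrableOn (fun x => (φ x - μ) ^ 2) (Icc c d) :=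
    (lintegral_ofReal_ne_top_iff_integrable hmeas
      (Eventually.of_forall fun x => sq_nonneg _)).1 (ne_top_of_le_ne_top (by simp) hle)
  refine ⟨hsq, ?_⟩
  rw [← ofReal_integral_eq_lintegral_ofReal hsq (Eventually.of_forall fun x => sq_nonneg _)] at hle
  exact (ENNReal.ofReal_le_ofReal_iff (mul_nonneg (sq_nonneg _) hL.le)).1 hle

/-- The integral John–Nirenberg inequality with a constant that is not yet optimal: any
`δ ∈ (ε, 1)` may take the place of `ε`. -/
lemma BMOBall.setLIntegral_exp_le {a b ε δ : ℝ} (hab : a < b) {φ : ℝ → ℝ}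
    (hφ : φ ∈ BMOBall a b ε) (hε : 0 ≤ ε) (hεδ : ε < δ) (h1 : δ < 1) :
    ∫⁻ x in Icc a b, ENNReal.ofReal (Real.exp (φ x)) ≤
      ENNReal.ofReal ((b - a) * (Real.exp ((⨍ x in Icc a b, φ x) - δ) / (1 - δ))) := by
  -- the function has to be integrable on the whole line for the primitive to be continuous there
  set ψ : ℝ → ℝ := (Icc a b).indicator φ with hψ
  have hint : IntegrableOn φ (Icc a b) := hφ.1.1
  have hψint : Integrable ψ := (integrable_indicator_iff measurableSet_Icc).2 hint
  have hψφ : ∀ x ∈ Icc a b, ψ x = φ x := fun x hx => indicator_of_mem hx φ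
  have hcongr : ∀ (c d : ℝ) (F : ℝ → ℝ), a ≤ c → d ≤ b →
      ∫ x in Ioo c d, F (ψ x) = ∫ x in Icc c d, F (φ x) := by
    intro c d F hac hdb
    rw [integral_Icc_eq_integral_Ioo]
    refine setIntegral_congr_fun measurableSet_Ioo fun x hx => ?_
    simp only [hψφ x ⟨hac.trans hx.1.le, hx.2.le.trans hdb⟩]
  have hmean : ∀ c d α : ℝ, a ≤ c → c < d → d ≤ b →
      (∫ x in Ioo c d, (ψ x - α) = 0 ↔ α = ⨍ x in Icc c d, φ x) := by
    intro c d α hac hcd hdb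
    have hL : d - c ≠ 0 := by linarith
    rw [hcongr c d (fun u => u - α) hac hdb, integral_sub
      (hint.mono_set (Icc_subset_Icc hac hdb)) (integrableOn_const (by simp)), setIntegral_const,
      setAverage_eq, Real.volume_real_Icc_of_le hcd.le, smul_eq_mul, smul_eq_mul,
      eq_inv_mul_iff_mul_eq₀ hL, sub_eq_zero, eq_comm]
  have hosc : OscLE ψ a b ε := by
    intro c d α hac hcd hdb h
    rw [hcongr c d (fun u => (u - α) ^ 2) hac hdb, (hmean c d α hac hcd hdb).1 h]
    exact (integral_sub_average_sq_le hφ hε hac hcd hdb).2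
  have hsq : IntegrableOn (fun x => ψ x ^ 2) (Ioo a b) := by
    set μ := ⨍ x in Icc a b, φ x
    have h2 := (integral_sub_average_sq_le hφ hε le_rfl hab le_rfl).1
    have h3 : IntegrableOn (fun x => φ x ^ 2) (Icc a b) := by
      have e : (fun x => φ x ^ 2) = fun x => (φ x - μ) ^ 2 + 2 * μ * φ x - μ ^ 2 := by
        ext x; ring
      rw [e]
      exact (h2.add (hint.const_mul _)).sub (integrableOn_const (by simp))
    refine (h3.mono_set Ioo_subset_Icc_self).congr_fun (fun x hx => ?_) measurableSet_Ioo
    simp only [hψφ x (Ioo_subset_Icc_self hx)]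
  have key := JohnNirenberg.setLIntegral_exp_le hab hψint hsq hosc hε hεδ h1
    ((hmean a b _ le_rfl hab le_rfl).2 rfl)
  rw [setLIntegral_congr Ioo_ae_eq_Icc.symm]
  refine le_trans (le_of_eq ?_) key
  refine setLIntegral_congr_fun measurableSet_Ioo fun x hx => ?_
  simp only [hψφ x (Ioo_subset_Icc_self hx)]

theorem BMOBall.expInequality {a b ε : ℝ} (hab : a < b) {φ : ℝ → ℝ} (hφ : φ ∈ BMOBall a b ε)
    (hε : 0 ≤ ε) (h1 : ε < 1) : ExpInequality a b (Real.exp (-ε) / (1 - ε)) φ := by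
  have hL : 0 < b - a := sub_pos.2 hab
  have hmeas : AEStronglyMeasurable (fun x => Real.exp (φ x)) (volume.restrict (Icc a b)) :=
    Real.continuous_exp.comp_aestronglyMeasurable hφ.1.1.aestronglyMeasurable
  have hint : IntegrableOn (fun x => Real.exp (φ x)) (Icc a b) :=
    (lintegral_ofReal_ne_top_iff_integrable hmeas
      (Eventually.of_forall fun x => (Real.exp_pos _).le)).1
      (ne_top_of_le_ne_top (by simp) (setLIntegral_exp_le hab hφ hε
        (by linarith : ε < (ε + 1) / 2) (by linarith)))
  refine ⟨hint, ?_⟩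
  set m := ⨍ x in Icc a b, φ x
  have hδ : ∀ δ ∈ Ioo ε 1,
      ⨍ x in Icc a b, Real.exp (φ x) ≤ Real.exp (-δ) / (1 - δ) * Real.exp m := by
    intro δ hδ
    have h := setLIntegral_exp_le hab hφ hε hδ.1 hδ.2
    have hδ1 : 0 < 1 - δ := sub_pos.2 hδ.2
    rw [← ofReal_integral_eq_lintegral_ofReal hint
      (Eventually.of_forall fun x => (Real.exp_pos _).le),
      ENNReal.ofReal_le_ofReal_iff (by positivity)] at h
    rw [setAverage_eq, Real.volume_real_Icc_of_le hab.le, smul_eq_mul, inv_mul_le_iff₀ hL]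
    refine h.trans (le_of_eq ?_)
    rw [sub_eq_add_neg _ δ, Real.exp_add]
    ring
  have hlim : Tendsto (fun δ => Real.exp (-δ) / (1 - δ) * Real.exp m) (𝓝[>] ε)
      (𝓝 (Real.exp (-ε) / (1 - ε) * Real.exp m)) := by
    have : ContinuousAt (fun δ => Real.exp (-δ) / (1 - δ) * Real.exp m) ε := by
      refine ContinuousAt.mul (ContinuousAt.div ?_ ?_ (by linarith)) continuousAt_const <;> fun_prop
    exact this.tendsto.mono_left nhdsWithin_le_nhds
  refine ge_of_tendsto hlim ?_
  filter_upwards [Ioo_mem_nhdsGT h1] with δ h using hδ δ h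

lemma le_of_expInequality_logExtremal {a b ε C : ℝ} (hab : a < b) (h1 : ε < 1)
    (h : ExpInequality a b C (logExtremal a ε)) : Real.exp (-ε) / (1 - ε) ≤ C := by
  have h2 := h.2
  rw [setAverage_logExtremal hab, setAverage_exp_logExtremal hab h1] at h2
  have e : Real.exp (-ε * Real.log (b - a)) / (1 - ε) =
      Real.exp (-ε) / (1 - ε) * Real.exp (ε - ε * Real.log (b - a)) := by
    rw [div_mul_eq_mul_div, ← Real.exp_add]
    ring_nf
  rw [e] at h2
  exact le_of_mul_le_mul_right h2 (Real.exp_pos _)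

end JohnNirenberg

theorem mainTheorem1 (a b : ℝ) (hab : a < b) :
    -- the inequality, for every `0 ≤ ε < 1`
    (∀ ε : ℝ, 0 ≤ ε → ε < 1 → ∀ φ ∈ JohnNirenberg.BMOBall a b ε,
      JohnNirenberg.ExpInequality a b (Real.exp (-ε) / (1 - ε)) φ) ∧
    -- the constant is sharp: no smaller one works
    (∀ ε : ℝ, 0 ≤ ε → ε < 1 → ∀ C : ℝ,
      (∀ φ ∈ JohnNirenberg.BMOBall a b ε, JohnNirenberg.ExpInequality a b C φ) →
        Real.exp (-ε) / (1 - ε) ≤ C) ∧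
    -- the threshold is sharp: from `ε = 1` on, no finite constant works
    (∀ ε : ℝ, 1 ≤ ε → ¬ ∃ C : ℝ,
      ∀ φ ∈ JohnNirenberg.BMOBall a b ε, JohnNirenberg.ExpInequality a b C φ) := by
  refine ⟨fun ε h0 h1 φ hφ => JohnNirenberg.BMOBall.expInequality hab hφ h0 h1,
    fun ε h0 h1 C h => ?_, ?_⟩
  · exact JohnNirenberg.le_of_expInequality_logExtremal hab h1
      (h _ (JohnNirenberg.logExtremal_mem_BMOBall hab h0))
  · rintro ε h1 ⟨C, h⟩
    have hmem := JohnNirenberg.logExtremal_mem_BMOBall hab zero_le_one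
    exact JohnNirenberg.not_integrableOn_exp_logExtremal_one hab
      (h _ ⟨hmem.1, hmem.2.trans (ENNReal.ofReal_le_ofReal h1)⟩).1
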